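/- Let $U_0$ be a compact metric space, let $Y\subset\mathbb R^m$ be closed and unbounded, let $U(\cdot):Y\leadsto U_0$ be an upper semicontinuous map with compact values, and let $f:\mathbb R^m\times U_0\to\mathbb R^m$ be continuous. Put $$G:=\{(y,u)\mid y\in Y,\ u\in U(y),\ f(y,u)\in Y\}.$$ An admissible process is a pair of sequences $(y(t),u(t))_{t\ge 0}$ with $y(t)\in Y$, $u(t)\in U(y(t))$ and $y(t+1)=f(y(t),u(t))$ for all $t\ge 0$. An admissible process up to time $S$ (where $S\ge 1$ is an integer) consists of $y(0),\dots,y(S)\in Y$ and $u(0),\dots,u(S-1)$ with $u(t)\in U(y(t))$ and $y(t+1)=f(y(t),u(t))$ for $0\le t<S$. Assume that for every $y_0\in Y$ there is an admissible process with $y(0)=y_0$, and that $|f(y,u)|\to\infty$ as $|y|\to\infty$, uniformly in $u$, for $(y,u)\in G$. For $\alpha\in(0,1)$ let $\Gamma_\alpha$ be the set of the probability measures $(1-\alpha)\sum_{t=0}^\infty\alpha^t\delta_{(y(t),u(t))}$ on $G$, taken over all admissible processes (with any $y(0)\in Y$). For integers $S\ge 1$ let $\Gamma(S)$ be the set of the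 probability measures $\frac1S\sum_{t=0}^{S-1}\delta_{(y(t),u(t))}$ on $G$, taken over all admissible processes up to time $S$ (with any $y(0)\in Y$). Let $\bar Y=Y\cup\{\infty_Y\}$ and $\bar G=G\cup\{\infty_G\}$ be the one-point compactifications, and let $\mathcal P(G)$ and $\mathcal P(\bar G)$ be the sets of Borel probability measures on $G$ and $\bar G$. The set $\mathcal P(\bar G)$ carries the weak$^*$ topology given by $C(\bar G)$, and $\mathcal P(G)$ is regarded as the set of the measures $\gamma\in\mathcal P(\bar G)$ with $\gamma(\{\infty_G\})=0$. Let $$W:=\Big\{\gamma\in\mathcal P(G)\ \Big|\ \int_G\big(\varphi(f(y,u))-\varphi(y)\big)\,d\gamma=0\quad\forall\,\varphi\in C(\bar Y)\Big\}.$$ Let $\mathrm{co}$ denote the convex hull. For sets $A_\alpha\subset\mathcal P(\bar G)$, let $\liminf_{\alpha\to1^-}A_\alpha$ be the set of all $\gamma\in\mathcal P(\bar G)$ such that for every sequence $\alpha_k\to1^-$ (with $\alpha_k<1$) there are $\gamma_k\in A_{\alpha_k}$ (for all large $k$) with $\gamma_k\to\gamma$. Let $\limsup_{\alpha\to1^-}A_\alpha$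 be the set of all $\gamma\in\mathcal P(\bar G)$ such that for some sequence $\alpha_k\to1^-$ (with $\alpha_k<1$) there are $\gamma_k\in A_{\alpha_k}$ (for all large $k$) with $\gamma_k\to\gamma$. The limits as $S\to\infty$ are defined in the same way, with sequences of integers $S_k\to\infty$. Then: (a) $\displaystyle\Big(\liminf_{\alpha\to1^-}\mathrm{co}\,\Gamma_\alpha\Big)\cap\mathcal P(G)=\Big(\limsup_{\alpha\to1^-}\mathrm{co}\,\Gamma_\alpha\Big)\cap\mathcal P(G)=W$; (b) $\displaystyle\Big(\liminf_{S\to\infty}\mathrm{co}\,\Gamma(S)\Big)\cap\mathcal P(G)=\Big(\limsup_{S\to\infty}\mathrm{co}\,\Gamma(S)\Big)\cap\mathcal P(G)=W$. -/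

import Mathlib

open MeasureTheory Filter Topology Set
open scoped NNReal ENNReal

/-- The one-point compactification carries its Borel σ-algebra. -/
instance OnePoint.instMeasurableSpaceBorel {X : Type*} [TopologicalSpace X] :
    MeasurableSpace (OnePoint X) := borel (OnePoint X)

instance OnePoint.instBorelSpaceBorel {X : Type*} [TopologicalSpace X] :
    BorelSpace (OnePoint X) := ⟨rfl⟩

namespace OccMeas

noncomputable section

/-! ### Kuratowski limits of families of sets, in terms of sequences -/

/-- Lower limit of the sets `A i` along the filter `l`: all `x` such that for every sequence
`s k → l` there are points `x k ∈ A (s k)` with `x k → x`. -/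
def lowerLim {ι X : Type*} [TopologicalSpace X] (l : Filter ι) (A : ι → Set X) : Set X :=
  {x | ∀ s : ℕ → ι, Tendsto s atTop l →
    ∃ p : ℕ → X, (∀ᶠ k in atTop, p k ∈ A (s k)) ∧ Tendsto p atTop (𝓝 x)}

/-- Upper limit of the sets `A i` along the filter `l`: all `x` such that for some sequence
`s k → l` there are points `x k ∈ A (s k)` with `x k → x`. -/
def upperLim {ι X : Type*} [TopologicalSpace X] (l : Filter ι) (A : ι → Set X) : Set X :=
  {x | ∃ s : ℕ → ι, Tendsto s atTop l ∧
    ∃ p : ℕ → X, (∀ᶠ k in atTop, p k ∈ A (s k)) ∧ Tendsto p atTop (𝓝 x)}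

/-! ### Probability measures on a space and on its one-point compactification -/

/-- The inclusion of `P(X)` in `P(X ∪ {∞})`. Its range is the set of the probability measures
that do not charge `∞`. The topology of `ProbabilityMeasure (OnePoint X)` is the weak* one,
tested against the continuous functions on `OnePoint X`. -/
def toCompact {X : Type*} [TopologicalSpace X] [MeasurableSpace X] [OpensMeasurableSpace X]
    (γ : ProbabilityMeasure X) : ProbabilityMeasure (OnePoint X) :=
  γ.map (f := ((↑) : X → OnePoint X)) OnePoint.continuous_coe.measurable.aemeasurable

/-- The convex hull `co Γ` of a set of probability measures (finite convex combinations). -/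
def co {X : Type*} [MeasurableSpace X] (Γ : Set (ProbabilityMeasure X)) :
    Set (ProbabilityMeasure X) :=
  {γ | (γ : Measure X) ∈ convexHull ℝ≥0 ((fun μ : ProbabilityMeasure X => (μ : Measure X)) '' Γ)}

/-! ### The control system -/

section System

variable {E U₀ : Type*} (Y : Set E) (U : E → Set U₀) (f : E × U₀ → E)

/-- `G = {(y, u) | y ∈ Y, u ∈ U(y), f(y, u) ∈ Y}`. -/
def G : Set (E × U₀) :=
  {z | z.1 ∈ Y ∧ z.2 ∈ U z.1 ∧ f z ∈ Y}

/-- The state component of a point of `G`, as a point of `Y`. -/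
def state (z : G Y U f) : Y := ⟨z.1.1, z.2.1⟩

/-- The successor state `f(y, u)` of a point `(y, u)` of `G`, as a point of `Y`. -/
def next (z : G Y U f) : Y := ⟨f z.1, z.2.2.2⟩

/-- Admissible processes on the infinite time horizon. -/
structure IsAdmissible (y : ℕ → E) (u : ℕ → U₀) : Prop where
  mem_Y : ∀ t, y t ∈ Y
  mem_U : ∀ t, u t ∈ U (y t)
  step : ∀ t, y (t + 1) = f (y t, u t)

/-- Admissible processes for the controls `u(0), …, u(S-1)`; the values `y t` with `t > S` and
`u t` with `t ≥ S` play no role. -/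
structure IsAdmissibleUpTo (S : ℕ) (y : ℕ → E) (u : ℕ → U₀) : Prop where
  mem_Y : ∀ t ≤ S, y t ∈ Y
  mem_U : ∀ t < S, u t ∈ U (y t)
  step : ∀ t < S, y (t + 1) = f (y t, u t)

variable {Y U f}

theorem IsAdmissible.mem_G {y : ℕ → E} {u : ℕ → U₀} (h : IsAdmissible Y U f y u) (t : ℕ) :
    (y t, u t) ∈ G Y U f :=
  ⟨h.mem_Y t, h.mem_U t, h.step t ▸ h.mem_Y (t + 1)⟩

theorem IsAdmissibleUpTo.mem_G {S : ℕ} {y : ℕ → E} {u : ℕ → U₀}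
    (h : IsAdmissibleUpTo Y U f S y u) (t : Fin S) : (y t, u t) ∈ G Y U f :=
  ⟨h.mem_Y t t.2.le, h.mem_U t t.2, h.step t t.2 ▸ h.mem_Y (t + 1) t.2⟩

variable [MeasurableSpace E] [MeasurableSpace U₀]

/-- The discounted occupational measure `(1 - α) ∑ α ^ t δ_{(y(t), u(t))}` on `G`. -/
def discountedOcc (α : ℝ) {y : ℕ → E} {u : ℕ → U₀} (h : IsAdmissible Y U f y u) :
    Measure (G Y U f) :=
  Measure.sum fun t : ℕ =>
    ENNReal.ofReal ((1 - α) * α ^ t) • Measure.dirac (⟨(y t, u t), h.mem_G t⟩ : G Y U f)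

/-- The averaging occupational measure `(1 / S) ∑_{t < S} δ_{(y(t), u(t))}` on `G`. -/
def averagingOcc (S : ℕ) {y : ℕ → E} {u : ℕ → U₀} (h : IsAdmissibleUpTo Y U f S y u) :
    Measure (G Y U f) :=
  ∑ t : Fin S, (S : ℝ≥0∞)⁻¹ • Measure.dirac (⟨(y t, u t), h.mem_G t⟩ : G Y U f)

variable (Y U f)

/-- `Γ_α(y₀)`. -/
def discountedOccSet (α : ℝ) (y₀ : E) : Set (ProbabilityMeasure (G Y U f)) :=
  {γ | ∃ (y : ℕ → E) (u : ℕ → U₀) (h : IsAdmissible Y U f y u),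
    y 0 = y₀ ∧ (γ : Measure (G Y U f)) = discountedOcc α h}

/-- `Γ(S, y₀)`. -/
def averagingOccSet (S : ℕ) (y₀ : E) : Set (ProbabilityMeasure (G Y U f)) :=
  {γ | ∃ (y : ℕ → E) (u : ℕ → U₀) (h : IsAdmissibleUpTo Y U f S y u),
    y 0 = y₀ ∧ (γ : Measure (G Y U f)) = averagingOcc S h}

/-- `Γ_α`, the union of `Γ_α(y₀)` over `y₀ ∈ Y`. -/
def Gam (α : ℝ) : Set (ProbabilityMeasure (G Y U f)) :=
  ⋃ y₀ ∈ Y, discountedOccSet Y U f α y₀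

/-- `Γ(S)`, the union of `Γ(S, y₀)` over `y₀ ∈ Y`. -/
def GamAvg (S : ℕ) : Set (ProbabilityMeasure (G Y U f)) :=
  ⋃ y₀ ∈ Y, averagingOccSet Y U f S y₀

/-- `W`, the probability measures on `G` with `∫ (φ(f(y,u)) - φ(y)) dγ = 0` for all continuous
real functions `φ` on the one-point compactification of `Y`. -/
def W [TopologicalSpace E] : Set (ProbabilityMeasure (G Y U f)) :=
  {γ | ∀ φ : C(OnePoint Y, ℝ),
    ∫ z, (φ (next Y U f z : OnePoint Y) - φ (state Y U f z : OnePoint Y))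
      ∂(γ : Measure (G Y U f)) = 0}

end System

end

end OccMeas

/-!
Write `s = state` and `n = next` for the two maps `G → Y`. A measure `γ` belongs to `W` exactly
when it is invariant, `n_* γ = s_* γ` (`map_next_eq_map_state`; testing against `C_c(Y)`, whose
elements extend by `0` to `OnePoint Y`, suffices).

*Upper limits lie in `W`.* Since `U₀` is compact and `f` is coercive, `s` and `n` are proper, so
`φ ∘ n - φ ∘ s` extends continuously to `OnePoint G` for each `φ ∈ C(OnePoint Y)`
(`exists_extension`). Its integrals against the occupational measures telescope and are at most
`2 (1 - α) ‖φ‖`, respectively `2 ‖φ‖ / S` (`abs_integral_discountedOcc_le`,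
`abs_integral_averagingOcc_le`). The bound passes to convex hulls and to the limit.

*`W` lies in the lower limits.* An invariant `γ` is in the closure of `co Γ_α` for every
`α ∈ (0, 1)` and of `co Γ(S)` for every `S ≥ 1`. Disintegrate `γ` along `s` into a kernel
`K : Y → P(G)`, and use it as a randomized stationary policy: the process started from `s_* γ` has
law `γ` at each time by invariance, so `γ` is the mean of the occupational measures of its
trajectories. The mean of a random element of a closed convex set stays in the set. To avoid
measures on the space of trajectories, the mean of `∑ w t • h (z t)` given the initial state is
built by backward recursion on the horizon (`exists_integrable_value`) for a vector-valued `h`;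
an infinite horizon is reached by truncation when `h` is bounded
(`tsum_smul_integral_mem_closedConvexHull`).
Finite families `h` of bounded continuous functions describe the weak topology
(`mem_closure_co`), and `P(G)` is pseudometrizable, so points of the closures can be approximated
along every sequence of parameters (`toCompact_mem_lowerLim`).
-/

namespace OccMeas

open ProbabilityTheory BoundedContinuousFunction TopologicalSpace

/-! ### Mean values along paths for an invariant measure -/

section Paths

variable {X Z : Type*}

/-- `IsPath s n x z`: the sequence `z` starts over `x` and each `z (t + 1)` lies over the successor
of `z t`, where `s` is the base-point map and `n` the successor map. -/
structure IsPath (s n : Z → X) (x : X) (z : ℕ → Z) : Prop where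
  start : s (z 0) = x
  step : ∀ t, s (z (t + 1)) = n (z t)

theorem IsPath.cons {s n : Z → X} {z : ℕ → Z} {z₀ : Z} (h : IsPath s n (n z₀) z) :
    IsPath s n (s z₀) (fun t => Nat.casesOn t z₀ z) := by
  refine ⟨rfl, fun t => ?_⟩
  cases t with
  | zero => exact h.start
  | succ t => exact h.step t

variable [MeasurableSpace X] [MeasurableSpace Z] [StandardBorelSpace Z] [StandardBorelSpace X]
  {V : Type*} [NormedAddCommGroup V] [NormedSpace ℝ V] [CompleteSpace V]

/-- Backward recursion on the horizon `k`: the function `v` is the conditional mean, given the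
initial point `x`, of `∑ t < k, w t • h (z t)` along the Markov chain obtained by disintegrating
`γ` over `s`. It lies almost everywhere in the closed convex hull of the sums along actual paths. -/
theorem exists_integrable_value {s n : Z → X} (hs : Measurable s) (hn : Measurable n)
    (hpath : ∀ x, ∃ z, IsPath s n x z) (γ : Measure Z) [IsProbabilityMeasure γ]
    (hinv : γ.map n = γ.map s) {h : Z → V} (hh : Integrable h γ) (k : ℕ) (w : ℕ → ℝ) :
    ∃ v : X → V, Integrable v (γ.map s) ∧
      (∀ᵐ x ∂γ.map s, v x ∈ closedConvexHull ℝ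
        {a | ∃ z, IsPath s n x z ∧ a = ∑ t ∈ Finset.range k, w t • h (z t)}) ∧
      ∫ x, v x ∂γ.map s = (∑ t ∈ Finset.range k, w t) • ∫ z, h z ∂γ := by
  induction k generalizing w with
  | zero =>
    refine ⟨0, integrable_zero _ _ _, ae_of_all _ fun x => subset_closedConvexHull ?_, by simp⟩
    obtain ⟨z, hz⟩ := hpath x
    exact ⟨z, hz, by simp⟩
  | succ k ih =>
    obtain ⟨v, hv, hvmem, hvint⟩ := ih (fun t => w (t + 1))
    have : Nonempty Z := nonempty_of_isProbabilityMeasure γ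
    -- invariance turns integrability for `s_* γ` into integrability for `n_* γ`
    have hvn : Integrable (fun z => v (n z)) γ := by
      rw [← hinv] at hv
      exact hv.comp_measurable hn
    set g : Z → V := fun z => w 0 • h z + v (n z) with hg_def
    have hg : Integrable g γ := (hh.smul (w 0)).add hvn
    set K := ProbabilityTheory.condDistrib id s γ
    have hKγ : (γ.map s) ⊗ₘ K = γ.map fun z => (s z, z) :=
      ProbabilityTheory.compProd_map_condDistrib measurable_id.aemeasurable
    have hsz : Measurable fun z => (s z, z) := hs.prodMk measurable_id
    have : IsProbabilityMeasure (γ.map s) := Measure.isProbabilityMeasure_map hs.aemeasurable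
    have hgsnd : AEStronglyMeasurable (fun p : X × Z => g p.2) ((γ.map s) ⊗ₘ K) := by
      refine AEStronglyMeasurable.comp_quasiMeasurePreserving (ν := γ) hg.1 ⟨measurable_snd, ?_⟩
      rw [hKγ, Measure.map_map measurable_snd hsz]
      exact (Measure.map_id (μ := γ)).absolutelyContinuous
    have hG : Integrable (fun p : X × Z => g p.2) ((γ.map s) ⊗ₘ K) := by
      rw [hKγ] at hgsnd ⊢
      exact (integrable_map_measure hgsnd hsz.aemeasurable).2 hg
    refine ⟨fun x => ∫ z, g z ∂K x, hG.integral_compProd, ?_, ?_⟩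
    -- the kernel `K x` is carried by the fibre of `s` over `x`, for almost every `x`
    · have hfib : ∀ᵐ p ∂((γ.map s) ⊗ₘ K), s p.2 = p.1 := by
        rw [hKγ]
        exact (ae_map_iff hsz.aemeasurable
          (measurableSet_eq_fun (hs.comp measurable_snd) measurable_fst)).2
            (ae_of_all _ fun _ => rfl)
      have hval : ∀ᵐ p ∂((γ.map s) ⊗ₘ K), v (n p.2) ∈ closedConvexHull ℝ
          {a | ∃ z, IsPath s n (n p.2) z ∧ a = ∑ t ∈ Finset.range k, w (t + 1) • h (z t)} := by
        rw [← hinv] at hvmem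
        have h1 := ae_of_ae_map hn.aemeasurable hvmem
        have h2 : γ = ((γ.map s) ⊗ₘ K).map Prod.snd := by
          rw [hKγ, Measure.map_map measurable_snd hsz]
          exact (Measure.map_id (μ := γ)).symm
        rw [h2] at h1
        exact ae_of_ae_map measurable_snd.aemeasurable h1
      filter_upwards [Measure.ae_ae_of_ae_compProd hfib, Measure.ae_ae_of_ae_compProd hval,
        ((Measure.integrable_compProd_iff hgsnd).1 hG).1] with x hx1 hx2 hx3
      refine convex_closedConvexHull.integral_mem isClosed_closedConvexHull ?_ hx3
      filter_upwards [hx1, hx2] with z₀ hz₀ hv₀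
      -- translation by `w 0 • h z₀` maps the values over `n z₀` to values over `s z₀`
      have hsub : closedConvexHull ℝ
          {a | ∃ z, IsPath s n (n z₀) z ∧ a = ∑ t ∈ Finset.range k, w (t + 1) • h (z t)} ⊆
          (fun a => w 0 • h z₀ + a) ⁻¹' closedConvexHull ℝ
            {a | ∃ z, IsPath s n x z ∧ a = ∑ t ∈ Finset.range (k + 1), w t • h (z t)} := by
        refine closedConvexHull_min ?_ (convex_closedConvexHull.translate_preimage_right _)
          (isClosed_closedConvexHull.preimage (by fun_prop))
        rintro a ⟨z, hz, rfl⟩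
        refine subset_closedConvexHull ⟨_, hz₀ ▸ hz.cons, ?_⟩
        simp only [Finset.sum_range_succ']
        exact add_comm _ _
      exact hsub hv₀
    · calc ∫ x, ∫ z, g z ∂K x ∂(γ.map s) = ∫ p, g p.2 ∂((γ.map s) ⊗ₘ K) :=
            (Measure.integral_compProd hG).symm
        _ = ∫ z, g z ∂γ := by
            rw [hKγ] at hgsnd ⊢
            exact integral_map hsz.aemeasurable hgsnd
        _ = w 0 • ∫ z, h z ∂γ + ∫ z, v (n z) ∂γ := by
            rw [← integral_smul]
            exact integral_add (hh.smul _) hvn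
        _ = _ := by
            rw [← hinv] at hv hvint
            rw [← integral_map hn.aemeasurable hv.1, hvint, ← add_smul, Finset.sum_range_succ',
              add_comm]

/-- For an invariant measure, the integral of `h` times the total weight is a limit of convex
combinations of weighted sums of `h` along paths of length `k`. -/
theorem smul_integral_mem_closedConvexHull {s n : Z → X} (hs : Measurable s) (hn : Measurable n)
    (hpath : ∀ x, ∃ z, IsPath s n x z) (γ : Measure Z) [IsProbabilityMeasure γ]
    (hinv : γ.map n = γ.map s) {h : Z → V} (hh : Integrable h γ) (k : ℕ) (w : ℕ → ℝ) :
    (∑ t ∈ Finset.range k, w t) • ∫ z, h z ∂γ ∈ closedConvexHull ℝ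
      {a | ∃ x z, IsPath s n x z ∧ a = ∑ t ∈ Finset.range k, w t • h (z t)} := by
  obtain ⟨v, hv, hvmem, hvint⟩ := exists_integrable_value hs hn hpath γ hinv hh k w
  have : IsProbabilityMeasure (γ.map s) := Measure.isProbabilityMeasure_map hs.aemeasurable
  rw [← hvint]
  refine convex_closedConvexHull.integral_mem isClosed_closedConvexHull ?_ hv
  filter_upwards [hvmem] with x hx
  refine (closedConvexHull ℝ).monotone ?_ hx
  rintro a ⟨z, hz⟩
  exact ⟨x, z, hz⟩

/-- The infinite-horizon version of `smul_integral_mem_closedConvexHull`: truncating at time `k`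
moves each weighted sum by at most `∑ t ≥ k, |w t| * M`. -/
theorem tsum_smul_integral_mem_closedConvexHull {s n : Z → X} (hs : Measurable s)
    (hn : Measurable n) (hpath : ∀ x, ∃ z, IsPath s n x z) (γ : Measure Z)
    [IsProbabilityMeasure γ] (hinv : γ.map n = γ.map s) {h : Z → V} (hh : Integrable h γ)
    {M : ℝ} (hM : ∀ z, ‖h z‖ ≤ M) {w : ℕ → ℝ} (hw : Summable w) :
    (∑' t, w t) • ∫ z, h z ∂γ ∈ closedConvexHull ℝ
      {a | ∃ x z, IsPath s n x z ∧ a = ∑' t, w t • h (z t)} := by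
  set C := closedConvexHull ℝ {a | ∃ x z, IsPath s n x z ∧ a = ∑' t, w t • h (z t)}
  have hlim : Tendsto (fun k => ∑' t, |w (t + k)| * M) atTop (𝓝 0) := by
    have := (tendsto_sum_nat_add fun t => |w t|).mul_const M
    simpa [tsum_mul_right] using this
  have hmem : ∀ k, (∑ t ∈ Finset.range k, w t) • ∫ z, h z ∂γ ∈
      Metric.cthickening (∑' t, |w (t + k)| * M) C := by
    intro k
    refine closedConvexHull_min ?_ (convex_closedConvexHull.cthickening _)
      Metric.isClosed_cthickening (smul_integral_mem_closedConvexHull hs hn hpath γ hinv hh k w)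
    rintro a ⟨x, z, hz, rfl⟩
    refine Metric.mem_cthickening_of_dist_le _ (∑' t, w t • h (z t)) _ _
      (subset_closedConvexHull ⟨x, z, hz, rfl⟩) ?_
    have hbd : ∀ t, ‖w t • h (z t)‖ ≤ |w t| * M := fun t => by
      rw [norm_smul, Real.norm_eq_abs]
      exact mul_le_mul_of_nonneg_left (hM _) (abs_nonneg _)
    have hsum : Summable fun t => w t • h (z t) :=
      Summable.of_norm_bounded (hw.abs.mul_right M) hbd
    rw [dist_eq_norm', ← hsum.sum_add_tsum_nat_add k, add_sub_cancel_left]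
    exact tsum_of_norm_bounded
      (((summable_nat_add_iff k).2 hw.abs).mul_right M).hasSum fun t => hbd _
  refine isClosed_closedConvexHull.closure_subset_iff.2 subset_rfl ?_
  rw [Metric.mem_closure_iff_infEDist_zero]
  refine le_antisymm (le_of_tendsto_of_tendsto
    (f := fun k => Metric.infEDist ((∑ t ∈ Finset.range k, w t) • ∫ z, h z ∂γ) C)
    (g := fun k => ENNReal.ofReal (∑' t, |w (t + k)| * M)) (b := atTop) ?_ ?_ ?_) bot_le
  · exact (Metric.continuous_infEDist.tendsto _).comp
      (hw.hasSum.tendsto_sum_nat.smul_const _)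
  · simpa [Function.comp_def] using (ENNReal.continuous_ofReal.tendsto 0).comp hlim
  · exact Eventually.of_forall fun k => Metric.mem_cthickening_iff.1 (hmem k)

end Paths

/-! ### Convex hulls of sets of probability measures -/

section ConvexHull

variable {Z : Type*} [MeasurableSpace Z]

theorem convex_setOf_integral_co {V : Type*} [NormedAddCommGroup V] [NormedSpace ℝ V]
    (Γ : Set (ProbabilityMeasure Z)) {h : Z → V}
    (hh : ∀ ν : ProbabilityMeasure Z, Integrable h (ν : Measure Z)) :
    Convex ℝ {a : V | ∃ ν ∈ co Γ, a = ∫ z, h z ∂(ν : Measure Z)} := by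
  rintro _ ⟨μ, hμ, rfl⟩ _ ⟨ν, hν, rfl⟩ p q hp hq hpq
  lift p to ℝ≥0 using hp
  lift q to ℝ≥0 using hq
  have hpq' : p + q = 1 := by exact_mod_cast hpq
  have hprob : IsProbabilityMeasure (p • (μ : Measure Z) + q • (ν : Measure Z)) := by
    constructor
    simp only [Measure.add_apply, Measure.smul_apply, measure_univ]
    simp only [ENNReal.smul_def, smul_eq_mul, mul_one]
    exact_mod_cast hpq'
  refine ⟨⟨_, hprob⟩, convex_convexHull ℝ≥0 _ hμ hν zero_le zero_le hpq', ?_⟩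
  rw [ProbabilityMeasure.coe_mk, integral_add_measure (hh μ).smul_measure_nnreal
    (hh ν).smul_measure_nnreal, integral_smul_nnreal_measure, integral_smul_nnreal_measure]
  rfl

theorem subset_co (Γ : Set (ProbabilityMeasure Z)) : Γ ⊆ co Γ :=
  fun ν hν => subset_convexHull ℝ≥0 _ ⟨ν, hν, rfl⟩

theorem abs_integral_le_of_mem_co {Γ : Set (ProbabilityMeasure Z)} {g : Z → ℝ} {c : ℝ}
    (hg : ∀ ν : ProbabilityMeasure Z, Integrable g (ν : Measure Z))
    (hΓ : ∀ ν ∈ Γ, |∫ z, g z ∂(ν : Measure Z)| ≤ c) {ν : ProbabilityMeasure Z} (hν : ν ∈ co Γ) :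
    |∫ z, g z ∂(ν : Measure Z)| ≤ c := by
  have hconv : Convex ℝ≥0 {μ : Measure Z | Integrable g μ ∧ |∫ z, g z ∂μ| ≤ c} := by
    rintro μ ⟨hμ, hμc⟩ μ' ⟨hμ', hμc'⟩ p q - - hpq
    refine ⟨hμ.smul_measure_nnreal.add_measure hμ'.smul_measure_nnreal, ?_⟩
    rw [integral_add_measure hμ.smul_measure_nnreal hμ'.smul_measure_nnreal,
      integral_smul_nnreal_measure, integral_smul_nnreal_measure]
    rw [abs_le] at *
    exact (convex_Icc (-c) c) hμc hμc' p.2 q.2 (by exact_mod_cast hpq)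
  refine (convexHull_min ?_ hconv hν).2
  rintro _ ⟨μ, hμ, rfl⟩
  exact ⟨hg μ, hΓ μ hμ⟩

end ConvexHull

section Weak

variable {Z : Type*} [TopologicalSpace Z] [MeasurableSpace Z] [OpensMeasurableSpace Z]

theorem integrable_finset_family (I : Finset (Z →ᵇ ℝ)) (ν : ProbabilityMeasure Z) :
    Integrable (fun z (g : I) => g.1 z) (ν : Measure Z) :=
  Integrable.of_eval fun g => g.1.integrable _

/-- Weak closure can be checked on finite families of bounded continuous functions, each of which
is treated as one function with values in a finite-dimensional space. -/
theorem mem_closure_co {Γ : Set (ProbabilityMeasure Z)} {γ : ProbabilityMeasure Z}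
    (H : ∀ I : Finset (Z →ᵇ ℝ), ∫ z, (fun g : I => g.1 z) ∂(γ : Measure Z) ∈
      closedConvexHull ℝ {a : I → ℝ | ∃ ν ∈ Γ, a = ∫ z, (fun g : I => g.1 z) ∂(ν : Measure Z)}) :
    γ ∈ closure (co Γ) := by
  classical
  have key : ∀ p : Finset (Z →ᵇ ℝ) × ℕ, ∃ ν ∈ co Γ, ∀ g ∈ p.1,
      dist (∫ z, g z ∂(ν : Measure Z)) (∫ z, g z ∂(γ : Measure Z)) < 1 / ((p.2 : ℝ) + 1) := by
    rintro ⟨I, n⟩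
    have hsub : closedConvexHull ℝ
        {a : I → ℝ | ∃ ν ∈ Γ, a = ∫ z, (fun g : I => g.1 z) ∂(ν : Measure Z)} ⊆
        closure {a : I → ℝ | ∃ ν ∈ co Γ, a = ∫ z, (fun g : I => g.1 z) ∂(ν : Measure Z)} := by
      refine closedConvexHull_min ?_
        (convex_setOf_integral_co Γ (integrable_finset_family I)).closure isClosed_closure
      rintro a ⟨ν, hν, rfl⟩
      exact subset_closure ⟨ν, subset_co Γ hν, rfl⟩
    obtain ⟨_, ⟨ν, hν, rfl⟩, hd⟩ := Metric.mem_closure_iff.1 (hsub (H I)) (1 / ((n : ℝ) + 1))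
      (by positivity)
    refine ⟨ν, hν, fun g hg => ?_⟩
    have h1 := (dist_le_pi_dist _ _ (⟨g, hg⟩ : I)).trans_lt hd
    rw [eval_integral fun i => (i.1.integrable _), eval_integral fun i => (i.1.integrable _),
      dist_comm] at h1
    exact h1
  -- the net of approximations is indexed by a finite family and a precision
  choose ν hν hd using key
  refine mem_closure_of_tendsto (f := ν) (b := atTop) ?_ (Eventually.of_forall hν)
  rw [ProbabilityMeasure.tendsto_iff_forall_integral_tendsto]
  intro g
  rw [Metric.tendsto_atTop]
  intro ε hε
  obtain ⟨n, hn⟩ := exists_nat_one_div_lt hε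
  refine ⟨({g}, n), fun p hp => (hd p g (hp.1 (Finset.mem_singleton_self g))).trans
    (lt_of_le_of_lt ?_ hn)⟩
  have : (n : ℝ) ≤ p.2 := by exact_mod_cast hp.2
  gcongr

theorem integral_toCompact (γ : ProbabilityMeasure Z) (Φ : C(OnePoint Z, ℝ)) :
    ∫ x, Φ x ∂(toCompact γ : Measure (OnePoint Z)) = ∫ z : Z, Φ z ∂(γ : Measure Z) := by
  rw [toCompact, ProbabilityMeasure.toMeasure_map]
  exact integral_map OnePoint.continuous_coe.measurable.aemeasurable
    Φ.continuous.measurable.aestronglyMeasurable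

theorem integral_eq_zero_of_mem_upperLim {ι : Type*} {l : Filter ι}
    {A : ι → Set (ProbabilityMeasure Z)} {γ : ProbabilityMeasure Z}
    (hγ : toCompact γ ∈ upperLim l (fun i => toCompact '' co (A i)))
    (Φ : C(OnePoint Z, ℝ)) {c : ι → ℝ} (hc : Tendsto c l (𝓝 0))
    (hA : ∀ᶠ i in l, ∀ ν ∈ A i, |∫ z : Z, Φ z ∂(ν : Measure Z)| ≤ c i) :
    ∫ z : Z, Φ z ∂(γ : Measure Z) = 0 := by
  obtain ⟨s, hs, p, hp, hlim⟩ := hγ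
  have hint : ∀ ν : ProbabilityMeasure Z, Integrable (fun z : Z => Φ z) (ν : Measure Z) :=
    fun ν => ((mkOfCompact Φ).compContinuous ⟨_, OnePoint.continuous_coe⟩).integrable _
  have h1 := (ProbabilityMeasure.tendsto_iff_forall_integral_tendsto.1 hlim) (mkOfCompact Φ)
  simp only [mkOfCompact_apply, integral_toCompact] at h1
  refine tendsto_nhds_unique h1 (squeeze_zero_norm' ?_ (hc.comp hs))
  filter_upwards [hp, hs.eventually hA] with k hk hAk
  obtain ⟨ν, hν, hνp⟩ := hk
  rw [← hνp, integral_toCompact]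
  exact abs_integral_le_of_mem_co hint hAk hν

end Weak

/-- As `P(Z)` is pseudometrizable, points of the closures can be approximated at a rate that is
uniform along any sequence of indices. -/
theorem toCompact_mem_lowerLim {Z : Type*} [TopologicalSpace Z] [PseudoMetrizableSpace Z]
    [SeparableSpace Z] [MeasurableSpace Z] [OpensMeasurableSpace Z] {ι : Type*} {l : Filter ι}
    {A : ι → Set (ProbabilityMeasure Z)} {γ : ProbabilityMeasure Z}
    (h : ∀ᶠ i in l, γ ∈ closure (co (A i))) :
    toCompact γ ∈ lowerLim l (fun i => toCompact '' co (A i)) := by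
  let : PseudoMetricSpace (ProbabilityMeasure Z) :=
    TopologicalSpace.pseudoMetrizableSpacePseudoMetric _
  intro s hs
  have hex : ∀ k, ∃ ν : ProbabilityMeasure Z, γ ∈ closure (co (A (s k))) →
      ν ∈ co (A (s k)) ∧ dist γ ν < 1 / ((k : ℝ) + 1) := by
    intro k
    by_cases hk : γ ∈ closure (co (A (s k)))
    · obtain ⟨ν, hν⟩ := Metric.mem_closure_iff.1 hk (1 / ((k : ℝ) + 1)) (by positivity)
      exact ⟨ν, fun _ => hν⟩
    · exact ⟨γ, fun h => absurd h hk⟩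
  choose ν hν using hex
  have hev := hs.eventually h
  refine ⟨fun k => toCompact (ν k), ?_, ?_⟩
  · filter_upwards [hev] with k hk using ⟨ν k, (hν k hk).1, rfl⟩
  · have hlim : Tendsto ν atTop (𝓝 γ) := by
      rw [tendsto_iff_dist_tendsto_zero]
      refine squeeze_zero' (Eventually.of_forall fun _ => dist_nonneg) ?_
        tendsto_one_div_add_atTop_nhds_zero_nat
      filter_upwards [hev] with k hk
      rw [dist_comm]
      exact (hν k hk).2.le
    exact ((ProbabilityMeasure.continuous_map OnePoint.continuous_coe).tendsto γ).comp hlim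

theorem lowerLim_subset_upperLim {ι X : Type*} [TopologicalSpace X] {l : Filter ι}
    [l.IsCountablyGenerated] [l.NeBot] (A : ι → Set X) : lowerLim l A ⊆ upperLim l A := by
  intro x hx
  obtain ⟨s, hs⟩ := exists_seq_tendsto l
  exact ⟨s, hs, hx s hs⟩

theorem kuratowski_limits_eq {Z : Type*} [TopologicalSpace Z] [MeasurableSpace Z]
    [OpensMeasurableSpace Z] {ι : Type*} {l : Filter ι} [l.IsCountablyGenerated] [l.NeBot]
    {A : ι → Set (ProbabilityMeasure Z)} {W : Set (ProbabilityMeasure Z)}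
    (hupper : ∀ γ, toCompact γ ∈ upperLim l (fun i => toCompact '' co (A i)) → γ ∈ W)
    (hlower : ∀ γ ∈ W, toCompact γ ∈ lowerLim l (fun i => toCompact '' co (A i))) :
    lowerLim l (fun i => toCompact '' co (A i)) ∩ range toCompact
        = upperLim l (fun i => toCompact '' co (A i)) ∩ range toCompact ∧
      upperLim l (fun i => toCompact '' co (A i)) ∩ range toCompact = toCompact '' W := by
  have h1 : upperLim l (fun i => toCompact '' co (A i)) ∩ range toCompact ⊆ toCompact '' W := by
    rintro _ ⟨h, γ, rfl⟩
    exact ⟨γ, hupper γ h, rfl⟩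
  have h2 : toCompact '' W ⊆ lowerLim l (fun i => toCompact '' co (A i)) ∩ range toCompact := by
    rintro _ ⟨γ, hγ, rfl⟩
    exact ⟨hlower γ hγ, γ, rfl⟩
  have h3 : lowerLim l (fun i => toCompact '' co (A i)) ∩ range toCompact ⊆
      upperLim l (fun i => toCompact '' co (A i)) ∩ range toCompact :=
    inter_subset_inter_left _ (lowerLim_subset_upperLim _)
  exact ⟨h3.antisymm (h1.trans h2), h1.antisymm (h2.trans h3)⟩

/-! ### Processes and their occupational measures -/

section Processes

variable {E U₀ : Type*} {Y : Set E} {U : E → Set U₀} {f : E × U₀ → E}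

theorem IsPath.isAdmissible {x : Y} {z : ℕ → G Y U f} (h : IsPath (state Y U f) (next Y U f) x z) :
    IsAdmissible Y U f (fun t => (z t).1.1) (fun t => (z t).1.2) where
  mem_Y t := (z t).2.1
  mem_U t := (z t).2.2.1
  step t := congrArg Subtype.val (h.step t)

theorem IsAdmissible.isPath {y : ℕ → E} {u : ℕ → U₀} (h : IsAdmissible Y U f y u) :
    IsPath (state Y U f) (next Y U f) ⟨y 0, h.mem_Y 0⟩ (fun t => ⟨(y t, u t), h.mem_G t⟩) where
  start := rfl
  step t := Subtype.ext (h.step t)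

theorem exists_isPath (hviable : ∀ y₀ ∈ Y, ∃ y u, IsAdmissible Y U f y u ∧ y 0 = y₀) (x : Y) :
    ∃ z, IsPath (state Y U f) (next Y U f) x z := by
  obtain ⟨y₀, hy₀⟩ := x
  obtain ⟨y, u, h, rfl⟩ := hviable y₀ hy₀
  exact ⟨_, h.isPath⟩

theorem IsAdmissible.upTo {y : ℕ → E} {u : ℕ → U₀} (h : IsAdmissible Y U f y u) (S : ℕ) :
    IsAdmissibleUpTo Y U f S y u :=
  ⟨fun t _ => h.mem_Y t, fun t _ => h.mem_U t, fun t _ => h.step t⟩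

theorem hasSum_discount {α : ℝ} (h0 : 0 < α) (h1 : α < 1) :
    HasSum (fun t : ℕ => (1 - α) * α ^ t) 1 := by
  have := (hasSum_geometric_of_lt_one h0.le h1).mul_left (1 - α)
  rwa [mul_inv_cancel₀ (by linarith)] at this

variable [MeasurableSpace E] [MeasurableSpace U₀]

theorem isProbabilityMeasure_discountedOcc {α : ℝ} (h0 : 0 < α) (h1 : α < 1) {y : ℕ → E}
    {u : ℕ → U₀} (h : IsAdmissible Y U f y u) : IsProbabilityMeasure (discountedOcc α h) := by
  constructor
  have hnn : ∀ t : ℕ, 0 ≤ (1 - α) * α ^ t := fun t =>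
    mul_nonneg (by linarith) (pow_nonneg h0.le t)
  simp only [discountedOcc, Measure.sum_apply _ MeasurableSet.univ, Measure.smul_apply,
    measure_univ, smul_eq_mul, mul_one]
  rw [← ENNReal.ofReal_tsum_of_nonneg hnn (hasSum_discount h0 h1).summable,
    (hasSum_discount h0 h1).tsum_eq, ENNReal.ofReal_one]

theorem isProbabilityMeasure_averagingOcc {S : ℕ} (hS : S ≠ 0) {y : ℕ → E}
    {u : ℕ → U₀} (h : IsAdmissibleUpTo Y U f S y u) : IsProbabilityMeasure (averagingOcc S h) := by
  constructor
  simp only [averagingOcc, Measure.finsetSum_apply, Measure.smul_apply, measure_univ, smul_eq_mul,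
    mul_one, Finset.sum_const, Finset.card_univ, Fintype.card_fin, nsmul_eq_mul]
  exact ENNReal.mul_inv_cancel (by exact_mod_cast hS) (ENNReal.natCast_ne_top S)

variable [MeasurableSingletonClass E] [MeasurableSingletonClass U₀]
  {V : Type*} [NormedAddCommGroup V] [NormedSpace ℝ V] [FiniteDimensional ℝ V]

theorem integral_discountedOcc {α : ℝ} (h0 : 0 < α) (h1 : α < 1) {y : ℕ → E} {u : ℕ → U₀}
    (h : IsAdmissible Y U f y u) (g : G Y U f → V) :
    ∫ z, g z ∂(discountedOcc α h) =
      ∑' t, ((1 - α) * α ^ t) • g ⟨(y t, u t), h.mem_G t⟩ := by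
  rw [discountedOcc, integral_sum_dirac fun _ => ENNReal.ofReal_ne_top]
  congr with t
  rw [ENNReal.toReal_ofReal (mul_nonneg (by linarith) (pow_nonneg h0.le t))]

theorem integral_averagingOcc {S : ℕ} (hS : S ≠ 0) {y : ℕ → E} {u : ℕ → U₀}
    (h : IsAdmissibleUpTo Y U f S y u) (g : G Y U f → V) :
    ∫ z, g z ∂(averagingOcc S h) =
      ∑ t : Fin S, (S : ℝ)⁻¹ • g ⟨(y t, u t), h.mem_G t⟩ := by
  rw [averagingOcc, ← Measure.sum_fintype, integral_sum_dirac fun _ => by simpa using hS,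
    tsum_fintype]
  simp

/-- By Abel summation, `∑ α ^ t (a (t + 1) - a t) = (1 - α) ∑ α ^ t a (t + 1) - a 0`. -/
theorem abs_integral_discountedOcc_le {α : ℝ} (h0 : 0 < α) (h1 : α < 1) {y : ℕ → E} {u : ℕ → U₀}
    (h : IsAdmissible Y U f y u) {φ : Y → ℝ} {M : ℝ} (hM : ∀ x, |φ x| ≤ M) :
    |∫ z, (φ (next Y U f z) - φ (state Y U f z)) ∂(discountedOcc α h)| ≤ (1 - α) * (2 * M) := by
  rw [integral_discountedOcc h0 h1 h]
  set a : ℕ → ℝ := fun t => φ ⟨y t, h.mem_Y t⟩ with ha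
  have hsum : Summable fun t => α ^ t * a t := by
    refine Summable.of_norm_bounded
      ((summable_geometric_of_lt_one h0.le h1).mul_right M) fun t => ?_
    rw [norm_mul, Real.norm_eq_abs, Real.norm_eq_abs, abs_of_nonneg (pow_nonneg h0.le t)]
    exact mul_le_mul_of_nonneg_left (hM _) (pow_nonneg h0.le t)
  have hb : ∀ t, ‖α ^ t * a (t + 1)‖ ≤ α ^ t * M := fun t => by
    rw [norm_mul, Real.norm_eq_abs, Real.norm_eq_abs, abs_of_nonneg (pow_nonneg h0.le t)]
    exact mul_le_mul_of_nonneg_left (hM _) (pow_nonneg h0.le t)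
  have hgeo := (hasSum_geometric_of_lt_one h0.le h1).mul_right M
  have hsum' : Summable fun t => α ^ t * a (t + 1) := Summable.of_norm_bounded hgeo.summable hb
  have hbd : |∑' t, α ^ t * a (t + 1)| ≤ (1 - α)⁻¹ * M := tsum_of_norm_bounded hgeo hb
  have hshift : ∑' t, α ^ t * a t = a 0 + α * ∑' t, α ^ t * a (t + 1) := by
    rw [hsum.tsum_eq_zero_add, ← tsum_mul_left]
    simp only [pow_zero, one_mul, pow_succ]
    congr 2 with t
    ring
  have hterm : ∀ t, ((1 - α) * α ^ t) • (φ (next Y U f ⟨(y t, u t), h.mem_G t⟩) -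
      φ (state Y U f ⟨(y t, u t), h.mem_G t⟩)) =
      (1 - α) * (α ^ t * a (t + 1) - α ^ t * a t) := fun t => by
    have : next Y U f ⟨(y t, u t), h.mem_G t⟩ = ⟨y (t + 1), h.mem_Y (t + 1)⟩ :=
      Subtype.ext (h.step t).symm
    rw [this, smul_eq_mul, ha, state]
    ring
  simp only [hterm]
  rw [tsum_mul_left, hsum'.tsum_sub hsum, hshift, abs_mul, abs_of_pos (by linarith : 0 < 1 - α)]
  refine mul_le_mul_of_nonneg_left ?_ (by linarith)
  set B := ∑' t, α ^ t * a (t + 1)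
  have h2 : B - (a 0 + α * B) = (1 - α) * B - a 0 := by ring
  have h3 : |(1 - α) * B| ≤ M := by
    rw [abs_mul, abs_of_pos (by linarith : 0 < 1 - α)]
    calc (1 - α) * |B| ≤ (1 - α) * ((1 - α)⁻¹ * M) :=
          mul_le_mul_of_nonneg_left hbd (by linarith)
      _ = M := by rw [← mul_assoc, mul_inv_cancel₀ (by linarith), one_mul]
  rw [h2]
  calc |(1 - α) * B - a 0| ≤ |(1 - α) * B| + |a 0| := abs_sub _ _
    _ ≤ 2 * M := by linarith [hM ⟨y 0, h.mem_Y 0⟩]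

theorem abs_integral_averagingOcc_le {S : ℕ} (hS : S ≠ 0) {y : ℕ → E} {u : ℕ → U₀}
    (h : IsAdmissibleUpTo Y U f S y u) {φ : Y → ℝ} {M : ℝ} (hM : ∀ x, |φ x| ≤ M) :
    |∫ z, (φ (next Y U f z) - φ (state Y U f z)) ∂(averagingOcc S h)| ≤ (S : ℝ)⁻¹ * (2 * M) := by
  classical
  rw [integral_averagingOcc hS h]
  -- the values of `φ` along the process, extended by `0` after time `S`
  set a : ℕ → ℝ := fun t => if ht : t ≤ S then φ ⟨y t, h.mem_Y t ht⟩ else 0 with ha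
  have hterm : ∀ t : Fin S, (S : ℝ)⁻¹ • (φ (next Y U f ⟨(y t, u t), h.mem_G t⟩) -
      φ (state Y U f ⟨(y t, u t), h.mem_G t⟩)) = (S : ℝ)⁻¹ * (a (t + 1) - a t) := fun t => by
    have h1 : next Y U f ⟨(y t, u t), h.mem_G t⟩ = ⟨y (t + 1), h.mem_Y (t + 1) t.2⟩ :=
      Subtype.ext (h.step t t.2).symm
    have h2 : (t : ℕ) + 1 ≤ S := t.2
    rw [h1, smul_eq_mul, ha, state]
    simp only [h2, t.2.le, dif_pos]
  simp only [hterm]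
  rw [← Finset.mul_sum, Fin.sum_univ_eq_sum_range (fun t => a (t + 1) - a t) S,
    Finset.sum_range_sub, abs_mul, abs_of_nonneg (by positivity : (0 : ℝ) ≤ (S : ℝ)⁻¹)]
  refine mul_le_mul_of_nonneg_left ?_ (by positivity)
  have h0 : |a 0| ≤ M := by simpa [ha] using hM _
  have h1 : |a S| ≤ M := by simpa [ha] using hM _
  linarith [abs_sub (a S) (a 0)]

end Processes

section Topology

variable {E U₀ : Type*} [NormedAddCommGroup E] [MetricSpace U₀] {Y : Set E} {U : E → Set U₀}
  {f : E × U₀ → E}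

/-- `U` has a closed graph over `Y`, being upper semicontinuous with compact values. -/
theorem isClosed_G (hY : IsClosed Y) (hUcompact : ∀ y ∈ Y, IsCompact (U y))
    (hU : UpperHemicontinuousOn U Y) (hf : Continuous f) : IsClosed (G Y U f) := by
  refine isClosed_of_closure_subset fun z hz => ?_
  have hzY : z.1 ∈ Y := closure_minimal (fun w hw => hw.1) (hY.preimage continuous_fst) hz
  refine ⟨hzY, ?_, closure_minimal (fun w hw => hw.2.2) (hY.preimage hf) hz⟩
  by_contra hzU
  obtain ⟨O, O', hO, hO', hUO, hzO', hdisj⟩ :=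
    (hUcompact _ hzY).separation_of_notMem hzU
  have h1 := eventually_nhdsWithin_iff.1 (hU.forall_isOpen z.1 hzY O hO hUO)
  have h2 : ∀ᶠ w in 𝓝 z, (w.1 ∈ Y → U w.1 ⊆ O) ∧ w.2 ∈ O' :=
    (continuous_fst.continuousAt.eventually h1).and
      (continuous_snd.continuousAt.eventually (hO'.mem_nhds hzO'))
  obtain ⟨w, hw, hwO, hwO'⟩ := ((mem_closure_iff_frequently.1 hz).and_eventually h2).exists
  exact hdisj.le_bot ⟨hwO hw.1 hw.2.1, hwO'⟩

theorem continuous_state : Continuous (state Y U f) :=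
  (continuous_fst.comp continuous_subtype_val).subtype_mk _

theorem continuous_next (hf : Continuous f) : Continuous (next Y U f) :=
  (hf.comp continuous_subtype_val).subtype_mk _

variable [ProperSpace E] [CompactSpace U₀]

theorem isCompact_of_bounded_state (hG : IsClosed (G Y U f)) {K : Set (G Y U f)}
    (hK : IsClosed K) {r : ℝ} (hr : ∀ z ∈ K, ‖z.1.1‖ ≤ r) : IsCompact K := by
  rw [Subtype.isCompact_iff]
  refine ((isCompact_closedBall (0 : E) r).prod (isCompact_univ (X := U₀))).of_isClosed_subset
    (hG.isClosedEmbedding_subtypeVal.isClosedMap _ hK) ?_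
  rintro _ ⟨z, hz, rfl⟩
  exact ⟨mem_closedBall_zero_iff.2 (hr z hz), mem_univ _⟩

theorem tendsto_state_coclosedCompact (hG : IsClosed (G Y U f)) :
    Tendsto (state Y U f) (coclosedCompact _) (coclosedCompact _) := by
  rw [hasBasis_coclosedCompact.tendsto_right_iff]
  rintro K ⟨hKc, hK⟩
  obtain ⟨r, hr⟩ := (hK.image continuous_subtype_val).isBounded.exists_norm_le
  have hc := hKc.preimage (continuous_state (Y := Y) (U := U) (f := f))
  exact (isCompact_of_bounded_state hG hc
    fun z hz => hr _ ⟨_, hz, rfl⟩).compl_mem_coclosedCompact_of_isClosed hc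

/-- Coercivity of `f` on `G` makes the successor map proper. -/
theorem tendsto_next_coclosedCompact (hG : IsClosed (G Y U f)) (hf : Continuous f)
    (hcoercive : ∀ R : ℝ, ∃ r : ℝ, ∀ z ∈ G Y U f, r ≤ ‖z.1‖ → R ≤ ‖f z‖) :
    Tendsto (next Y U f) (coclosedCompact _) (coclosedCompact _) := by
  rw [hasBasis_coclosedCompact.tendsto_right_iff]
  rintro K ⟨hKc, hK⟩
  obtain ⟨R, hR⟩ := (hK.image continuous_subtype_val).isBounded.exists_norm_le
  obtain ⟨r, hr⟩ := hcoercive (R + 1)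
  have hc := hKc.preimage (continuous_next (Y := Y) (U := U) hf)
  refine (isCompact_of_bounded_state (r := r) hG hc
    fun z hz => ?_).compl_mem_coclosedCompact_of_isClosed hc
  by_contra! hlt
  have h1 := hr z.1 z.2 hlt.le
  have h2 : ‖f z.1‖ ≤ R := hR _ ⟨_, hz, rfl⟩
  linarith

/-- Both maps `G → Y` are proper, hence extend to the one-point compactifications. -/
theorem exists_extension (hG : IsClosed (G Y U f)) (hf : Continuous f)
    (hcoercive : ∀ R : ℝ, ∃ r : ℝ, ∀ z ∈ G Y U f, r ≤ ‖z.1‖ → R ≤ ‖f z‖) (φ : C(OnePoint Y, ℝ)) :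
    ∃ Φ : C(OnePoint (G Y U f), ℝ), ∀ z : G Y U f,
      Φ z = φ (next Y U f z : OnePoint Y) - φ (state Y U f z : OnePoint Y) :=
  ⟨φ.comp ⟨_, OnePoint.continuous_map (continuous_next hf)
      (tendsto_next_coclosedCompact hG hf hcoercive)⟩ -
    φ.comp ⟨_, OnePoint.continuous_map continuous_state (tendsto_state_coclosedCompact hG)⟩,
    fun _ => rfl⟩

variable [MeasurableSpace E] [BorelSpace E] [MeasurableSpace U₀] [BorelSpace U₀]

/-- The elements of `W` are invariant: the current and the next state have the same law. -/
theorem map_next_eq_map_state (hY : IsClosed Y) (hf : Continuous f)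
    {γ : ProbabilityMeasure (G Y U f)} (hγ : γ ∈ W Y U f) :
    (γ : Measure (G Y U f)).map (next Y U f) = (γ : Measure (G Y U f)).map (state Y U f) := by
  have : ProperSpace Y := .of_isClosed hY
  have hn := (continuous_next (Y := Y) (U := U) hf)
  have hs := (continuous_state (Y := Y) (U := U) (f := f))
  have : IsProbabilityMeasure ((γ : Measure (G Y U f)).map (next Y U f)) :=
    Measure.isProbabilityMeasure_map hn.measurable.aemeasurable
  have : IsProbabilityMeasure ((γ : Measure (G Y U f)).map (state Y U f)) :=
    Measure.isProbabilityMeasure_map hs.measurable.aemeasurable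
  refine Measure.ext_of_integral_eq_on_compactlySupported fun g => ?_
  have hg0 : Tendsto g (coclosedCompact Y) (𝓝 0) := by
    rw [coclosedCompact_eq_cocompact]
    exact g.hasCompactSupport.is_zero_at_infty
  have hint := hγ (OnePoint.continuousMapMk g.toContinuousMap 0 hg0)
  have hgm : Measurable g := g.continuous.measurable
  rw [integral_map hn.measurable.aemeasurable hgm.aestronglyMeasurable,
    integral_map hs.measurable.aemeasurable hgm.aestronglyMeasurable]
  have hgi : ∀ μ : Measure Y, IsProbabilityMeasure μ → Integrable g μ := fun μ _ =>
    g.continuous.integrable_of_hasCompactSupport g.hasCompactSupport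
  have hin : Integrable (fun z => g (next Y U f z)) (γ : Measure (G Y U f)) :=
    (hgi _ ‹_›).comp_measurable hn.measurable
  have his : Integrable (fun z => g (state Y U f z)) (γ : Measure (G Y U f)) :=
    (hgi _ ‹_›).comp_measurable hs.measurable
  rw [← sub_eq_zero, ← integral_sub hin his]
  exact hint

end Topology

/-! ### Invariant measures and limits of occupational measures -/

section Approximation

variable {E U₀ : Type*} [NormedAddCommGroup E] [ProperSpace E] [MetricSpace U₀] [CompactSpace U₀]
  {Y : Set E} {U : E → Set U₀} {f : E × U₀ → E}
  [MeasurableSpace E] [BorelSpace E] [MeasurableSpace U₀] [BorelSpace U₀]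

theorem mem_closure_co_Gam (hY : IsClosed Y) (hG : IsClosed (G Y U f)) (hf : Continuous f)
    (hviable : ∀ y₀ ∈ Y, ∃ y u, IsAdmissible Y U f y u ∧ y 0 = y₀)
    {γ : ProbabilityMeasure (G Y U f)} (hγ : γ ∈ W Y U f) {α : ℝ} (h0 : 0 < α) (h1 : α < 1) :
    γ ∈ closure (co (Gam Y U f α)) := by
  have : PolishSpace Y := hY.polishSpace
  have : PolishSpace (G Y U f) := hG.polishSpace
  refine mem_closure_co fun I => ?_
  have hM : ∀ z : G Y U f, ‖(fun g : I => g.1 z)‖ ≤ ∑ g : I, ‖g.1‖ := fun z =>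
    (pi_norm_le_iff_of_nonneg (Finset.sum_nonneg fun _ _ => norm_nonneg _)).2 fun g =>
      (g.1.norm_coe_le_norm z).trans
        (Finset.single_le_sum (f := fun g : I => ‖g.1‖) (fun _ _ => norm_nonneg _)
          (Finset.mem_univ g))
  have key := tsum_smul_integral_mem_closedConvexHull continuous_state.measurable
    (continuous_next hf).measurable (exists_isPath hviable) (γ : Measure (G Y U f))
    (map_next_eq_map_state hY hf hγ)
    (integrable_finset_family I γ) hM (hasSum_discount h0 h1).summable
  rw [(hasSum_discount h0 h1).tsum_eq, one_smul] at key
  refine (closedConvexHull ℝ).monotone ?_ key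
  rintro _ ⟨x, z, hz, rfl⟩
  have hp := isProbabilityMeasure_discountedOcc h0 h1 hz.isAdmissible
  refine ⟨⟨_, hp⟩, mem_biUnion (z 0).2.1 ⟨_, _, hz.isAdmissible, rfl, rfl⟩, ?_⟩
  exact (integral_discountedOcc h0 h1 hz.isAdmissible fun z (g : I) => g.1 z).symm

theorem mem_closure_co_GamAvg (hY : IsClosed Y) (hG : IsClosed (G Y U f)) (hf : Continuous f)
    (hviable : ∀ y₀ ∈ Y, ∃ y u, IsAdmissible Y U f y u ∧ y 0 = y₀)
    {γ : ProbabilityMeasure (G Y U f)} (hγ : γ ∈ W Y U f) {S : ℕ} (hS : S ≠ 0) :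
    γ ∈ closure (co (GamAvg Y U f S)) := by
  have : PolishSpace Y := hY.polishSpace
  have : PolishSpace (G Y U f) := hG.polishSpace
  refine mem_closure_co fun I => ?_
  have key := smul_integral_mem_closedConvexHull continuous_state.measurable
    (continuous_next hf).measurable (exists_isPath hviable) (γ : Measure (G Y U f))
    (map_next_eq_map_state hY hf hγ)
    (integrable_finset_family I γ) S (fun _ => (S : ℝ)⁻¹)
  have hS' : (S : ℝ) ≠ 0 := by exact_mod_cast hS
  rw [Finset.sum_const, Finset.card_range, nsmul_eq_mul, mul_inv_cancel₀ hS', one_smul] at key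
  refine (closedConvexHull ℝ).monotone ?_ key
  rintro _ ⟨x, z, hz, rfl⟩
  have h := hz.isAdmissible.upTo S
  have hp := isProbabilityMeasure_averagingOcc hS h
  refine ⟨⟨_, hp⟩, mem_biUnion (z 0).2.1 ⟨_, _, h, rfl, rfl⟩, ?_⟩
  refine Eq.trans ?_ (integral_averagingOcc hS h _).symm
  exact (Fin.sum_univ_eq_sum_range (fun t => (S : ℝ)⁻¹ • fun g : I => g.1 (z t)) S).symm

/-- If `∫ (φ ∘ next - φ ∘ state)` tends to `0` uniformly on the sets `A i`, then the upper limit of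
their convex hulls consists, off `∞`, of elements of `W`. -/
theorem mem_W_of_mem_upperLim {ι : Type*} {l : Filter ι} (hG : IsClosed (G Y U f))
    (hf : Continuous f)
    (hcoercive : ∀ R : ℝ, ∃ r : ℝ, ∀ z ∈ G Y U f, r ≤ ‖z.1‖ → R ≤ ‖f z‖)
    {A : ι → Set (ProbabilityMeasure (G Y U f))} {c : ι → ℝ} (hc : Tendsto c l (𝓝 0))
    (hA : ∀ (φ : Y → ℝ) (M : ℝ), (∀ x, |φ x| ≤ M) → ∀ᶠ i in l, ∀ ν ∈ A i,
      |∫ z, (φ (next Y U f z) - φ (state Y U f z)) ∂(ν : Measure (G Y U f))| ≤ c i * (2 * M))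
    {γ : ProbabilityMeasure (G Y U f)}
    (hγ : toCompact γ ∈ upperLim l (fun i => toCompact '' co (A i))) : γ ∈ W Y U f := by
  intro φ
  obtain ⟨Φ, hΦ⟩ := exists_extension hG hf hcoercive φ
  simp only [← hΦ]
  refine integral_eq_zero_of_mem_upperLim hγ Φ (c := fun i => c i * (2 * ‖φ‖))
    (by simpa using hc.mul_const (2 * ‖φ‖)) ?_
  simp only [hΦ]
  exact hA (fun x => φ (x : OnePoint Y)) ‖φ‖ fun x => φ.norm_coe_le_norm x

end Approximation

end OccMeas

open OccMeas in
theorem theorem4p3 {m : ℕ} {U₀ : Type*} [MetricSpace U₀] [CompactSpace U₀]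
    [MeasurableSpace U₀] [BorelSpace U₀]
    (Y : Set (EuclideanSpace ℝ (Fin m))) (hYclosed : IsClosed Y)
    (hYunbdd : ¬ Bornology.IsBounded Y)
    (U : EuclideanSpace ℝ (Fin m) → Set U₀)
    (hUcompact : ∀ y ∈ Y, IsCompact (U y)) (hUusc : UpperHemicontinuousOn U Y)
    (f : EuclideanSpace ℝ (Fin m) × U₀ → EuclideanSpace ℝ (Fin m)) (hf : Continuous f)
    (hviable : ∀ y₀ ∈ Y, ∃ y u, IsAdmissible Y U f y u ∧ y 0 = y₀)
    (hcoercive : ∀ R : ℝ, ∃ r : ℝ, ∀ z ∈ G Y U f, r ≤ ‖z.1‖ → R ≤ ‖f z‖) :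
    (lowerLim (𝓝[<] (1 : ℝ)) (fun α => toCompact '' co (Gam Y U f α)) ∩ range toCompact
        = upperLim (𝓝[<] (1 : ℝ)) (fun α => toCompact '' co (Gam Y U f α)) ∩ range toCompact ∧
      upperLim (𝓝[<] (1 : ℝ)) (fun α => toCompact '' co (Gam Y U f α)) ∩ range toCompact
        = toCompact '' W Y U f) ∧
    (lowerLim atTop (fun S : ℕ => toCompact '' co (GamAvg Y U f S)) ∩ range toCompact
        = upperLim atTop (fun S : ℕ => toCompact '' co (GamAvg Y U f S)) ∩ range toCompact ∧
      upperLim atTop (fun S : ℕ => toCompact '' co (GamAvg Y U f S)) ∩ range toCompact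
        = toCompact '' W Y U f) := by
  have hG := isClosed_G hYclosed hUcompact hUusc hf
  have hα : ∀ᶠ α : ℝ in 𝓝[<] 1, 0 < α ∧ α < 1 :=
    Ioo_mem_nhdsLT zero_lt_one
  constructor
  · refine kuratowski_limits_eq (fun γ => mem_W_of_mem_upperLim hG hf hcoercive
      (c := fun α => 1 - α) ?_ fun φ M hM => ?_) fun γ hγ => toCompact_mem_lowerLim ?_
    · have : Tendsto (fun α : ℝ => 1 - α) (𝓝 1) (𝓝 (1 - 1)) := tendsto_const_nhds.sub tendsto_id
      rw [sub_self] at this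
      exact this.mono_left nhdsWithin_le_nhds
    · filter_upwards [hα] with α ⟨h0, h1⟩ ν hν
      obtain ⟨y₀, -, y, u, h, -, hν⟩ := mem_iUnion₂.1 hν
      rw [hν]
      exact abs_integral_discountedOcc_le h0 h1 h hM
    · filter_upwards [hα] with α ⟨h0, h1⟩
      exact mem_closure_co_Gam hYclosed hG hf hviable hγ h0 h1
  · refine kuratowski_limits_eq (fun γ => mem_W_of_mem_upperLim hG hf hcoercive
      tendsto_inv_atTop_nhds_zero_nat fun φ M hM => ?_) fun γ hγ => toCompact_mem_lowerLim ?_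
    · filter_upwards [eventually_ne_atTop 0] with S hS ν hν
      obtain ⟨y₀, -, y, u, h, -, hν⟩ := mem_iUnion₂.1 hν
      rw [hν]
      exact abs_integral_averagingOcc_le hS h hM
    · filter_upwards [eventually_ne_atTop 0] with S hS
      exact mem_closure_co_GamAvg hYclosed hG hf hviable hγ hS
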